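/- Fix an integer $n\ge 1$. For a probability distribution $F$ on $[0,\infty)$ with finite mean let $X_1,\dots,X_n$ be i.i.d. with distribution $F$ and $M_n(F)=\mathbb E\max_{1\le t\le n}X_t$. For $\theta\ge 0$ and $p\in[0,1]$ let $\xi_1,\dots,\xi_n$ be i.i.d. Bernoulli$(p)$ variables independent of $(X_t)$, let $\tau_p(\theta)$ be the smallest $t\in\{1,\dots,n-1\}$ such that $X_t>\theta$, or $X_t=\theta$ and $\xi_t=1$, with $\tau_p(\theta)=n$ if there is no such $t$, and put $V_n(\tau_p(\theta);F)=\mathbb E X_{\tau_p(\theta)}$. Define $$\mathcal R_n^*=\inf_F\ \sup_{\theta\ge0,\,p\in[0,1]}\frac{V_n(\tau_p(\theta);F)}{M_n(F)},\qquad \mathcal A_n^*=\sup_F\ \inf_{\theta\ge0,\,p\in[0,1]}\bigl\{M_n(F)-V_n(\tau_p(\theta);F)\bigr\},$$ where the infimum is over all distributions $F$ on $[0,\infty)$ with finite mean, other than the unit mass at $0$, and the supremum is over all distributions $F$ on $[0,1]$. For $x,y\in[0,1]$ put $$W(x,y)=(1-x^{n-1})\min\Bigl\{1,\frac{1-y}{1-x}\Bigr\}+x^{n-1}(1-y),\qquad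 A(x,y)=1-y^n-W(x,y),$$ where the first summand of $W$ is read as $0$ for $x=1$, and $R(x,y)=W(x,y)/(1-y^n)$ for $y<1$, $R(x,1)=\frac1n\sum_{k=0}^{n-1}x^k$. Thus $R(x,y)=\frac{1-x^{n-1}y}{1-y^n}$ for $x>y$, $R(x,y)=\bigl(\sum_{k=0}^{n-1}x^k\bigr)/\bigl(\sum_{k=0}^{n-1}y^k\bigr)$ for $x<y$, and $R(x,x)=1$. For probability measures $\lambda,\mu$ on $[0,1]$ let $\bar R(\lambda,\mu)=\int_0^1\int_0^1R(x,y)\,d\lambda(x)\,d\mu(y)$ and $\bar A(\lambda,\mu)=\int_0^1\int_0^1A(x,y)\,d\lambda(x)\,d\mu(y)$. Then $$\mathcal R_n^*=\inf_\mu\sup_\lambda\bar R(\lambda,\mu),\qquad \mathcal A_n^*=\sup_\mu\inf_\lambda\bar A(\lambda,\mu),$$ where $\lambda$ and $\mu$ range over all probability measures on $[0,1]$. Moreover, let $F^{\leftarrow}(t)=\inf\{z\ge0:F(z)\ge t\}$ be the quantile function, and let $dF^{\leftarrow}$ be its Lebesgue–Stieltjes measure: the measure on $[0,1]$ without an atom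 at $1$ that satisfies $dF^{\leftarrow}([0,t))=F^{\leftarrow}(t)$ for $t\in[0,1]$. (a) For every distribution $F$ on $[0,\infty)$ with finite mean and all $\theta\ge0$, $p\in[0,1]$, $$M_n(F)=\int(1-y^n)\,dF^{\leftarrow}(y),\qquad V_n(\tau_p(\theta);F)=\int W(x,y)\,dF^{\leftarrow}(y),\quad x=pF(\theta-)+(1-p)F(\theta),$$ with integrable integrands. (b) If $F$ is moreover not the unit mass at $0$, then $d\mu=M_n(F)^{-1}(1-y^n)\,dF^{\leftarrow}$ is a probability measure on $[0,1]$ and $\sup_{\theta,p}V_n(\tau_p(\theta);F)/M_n(F)=\sup_\lambda\bar R(\lambda,\mu)$. Every probability measure $\mu$ on $[0,1]$ with $\mu(\{1\})=0$ is $(1-y^n)\,dF^{\leftarrow}$ for some such $F$ with $M_n(F)=1$. (c) For every distribution $F$ on $[0,1]$ there is a probability measure $\mu$ on $[0,1]$ that coincides with $dF^{\leftarrow}$ on $[0,1)$, and it satisfies $\inf_{\theta,p}\{M_n(F)-V_n(\tau_p(\theta);F)\}=\inf_\lambda\bar A(\lambda,\mu)$. Every probability measure $\mu$ on $[0,1]$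 coincides on $[0,1)$ with $dF^{\leftarrow}$ for some distribution $F$ on $[0,1]$. -/

import Mathlib

open MeasureTheory ProbabilityTheory Set
open scoped NNReal ENNReal unitInterval

noncomputable section

namespace Prophet

/-! ### Distributions -/

/-- Distributions on `[0, ∞)` with finite mean, other than the unit mass at `0`. -/
def distNonneg : Set (ProbabilityMeasure ℝ) :=
  {F | (F : Measure ℝ) (Iio 0) = 0 ∧ Integrable (fun x : ℝ => x) (F : Measure ℝ) ∧
    (F : Measure ℝ) (Ioi 0) ≠ 0}

/-- Distributions on `[0, 1]`. -/
def distUnit : Set (ProbabilityMeasure ℝ) :=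
  {F | (F : Measure ℝ) (Icc 0 1)ᶜ = 0}

/-! ### The prophet and the randomized single-threshold rules

The horizon is `n ≥ 1`, and the times `1, …, n` are the elements `0, …, n - 1` of `Fin n`. -/

/-- `M_n(F) = E max (X_1, …, X_n)` for iid `X_t ∼ F`. -/
def prophetValue (n : ℕ) (F : ProbabilityMeasure ℝ) : ℝ :=
  ∫ X : Fin n → ℝ, (⨆ t, X t) ∂(Measure.pi fun _ => (F : Measure ℝ))

/-- The law of the iid pairs `(X_t, ξ_t)`, with `X_t ∼ F` and `ξ_t` a Bernoulli variable with
success probability `p` that is independent of `X_t`. -/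
def sampleLaw (n : ℕ) (F : ProbabilityMeasure ℝ) (p : I) : Measure (Fin n → ℝ × Bool) :=
  Measure.pi fun _ => (F : Measure ℝ).prod (bernoulliMeasure true false p)

open Classical in
/-- The times strictly before the last one at which the rule with threshold `θ` accepts:
`X_t > θ`, or `X_t = θ` and `ξ_t = 1`. -/
def acceptTimes (n : ℕ) (θ : ℝ) (ω : Fin n → ℝ × Bool) : Finset (Fin n) :=
  Finset.univ.filter fun t =>
    (t : ℕ) + 1 < n ∧ (θ < (ω t).1 ∨ ((ω t).1 = θ ∧ (ω t).2 = true))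

/-- The stopping rule with threshold `θ`: the first accepting time before the last one,
or the last time if there is none. -/
def stopTime (n : ℕ) [NeZero n] (θ : ℝ) (ω : Fin n → ℝ × Bool) : Fin n :=
  if h : (acceptTimes n θ ω).Nonempty then (acceptTimes n θ ω).min' h
  else ⟨n - 1, Nat.sub_lt (NeZero.pos n) Nat.one_pos⟩

/-- `V_n(τ_p(θ); F) = E X_{τ_p(θ)}`. -/
def reward (n : ℕ) [NeZero n] (F : ProbabilityMeasure ℝ) (θ : ℝ) (p : I) : ℝ :=
  ∫ ω, (ω (stopTime n θ ω)).1 ∂(sampleLaw n F p)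

/-- The competitive ratio of the optimal randomized single-threshold rule for `F`. -/
def optRatio (n : ℕ) [NeZero n] (F : ProbabilityMeasure ℝ) : EReal :=
  ⨆ (θ : ℝ≥0) (p : I), ((reward n F θ p / prophetValue n F : ℝ) : EReal)

/-- The regret of the optimal randomized single-threshold rule for `F`. -/
def optRegret (n : ℕ) [NeZero n] (F : ProbabilityMeasure ℝ) : EReal :=
  ⨅ (θ : ℝ≥0) (p : I), ((prophetValue n F - reward n F θ p : ℝ) : EReal)

/-- The worst-case competitive ratio over distributions on `[0, ∞)`. -/
def worstRatio (n : ℕ) [NeZero n] : EReal :=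
  ⨅ F ∈ distNonneg, optRatio n F

/-- The worst-case regret over distributions on `[0, 1]`. -/
def worstRegret (n : ℕ) [NeZero n] : EReal :=
  ⨆ F ∈ distUnit, optRegret n F

/-! ### The two games on the unit square -/

/-- The kernel `R(x, y)`. The value at `y = 1` is the limit as `y ↑ 1` if `x < 1`, and
`R(1, 1) = 1`. (For `x = 1 > y` the first summand is `0`, whatever `(1 - y) / 0` is.) -/
def kernelR (n : ℕ) (x y : ℝ) : ℝ :=
  if y < 1 then
    (1 - x ^ (n - 1)) / (1 - y ^ n) * min 1 ((1 - y) / (1 - x))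
      + x ^ (n - 1) * ((1 - y) / (1 - y ^ n))
  else (∑ k ∈ Finset.range n, x ^ k) / n

/-- The kernel `A(x, y)`. (For `x = 1` the product with the minimum is `0`.) -/
def kernelA (n : ℕ) (x y : ℝ) : ℝ :=
  1 - y ^ n - (1 - x ^ (n - 1)) * min 1 ((1 - y) / (1 - x)) - x ^ (n - 1) * (1 - y)

/-- `∫∫ R(x, y) dλ(x) dμ(y)`. -/
def avgR (n : ℕ) (lam μ : ProbabilityMeasure I) : ℝ :=
  ∫ y, ∫ x, kernelR n (x : ℝ) (y : ℝ) ∂(lam : Measure I) ∂(μ : Measure I)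

/-- `∫∫ A(x, y) dλ(x) dμ(y)`. -/
def avgA (n : ℕ) (lam μ : ProbabilityMeasure I) : ℝ :=
  ∫ y, ∫ x, kernelA n (x : ℝ) (y : ℝ) ∂(lam : Measure I) ∂(μ : Measure I)

/-! ### The quantile function -/

/-- `(1 - x ^ (n - 1)) min {1, (1 - y) / (1 - x)} + x ^ (n - 1) (1 - y)`: the integrand that
represents the reward of a rule with `F_p(θ) = x` as an integral with respect to `dF^←`. -/
def rewardKernel (n : ℕ) (x y : ℝ) : ℝ :=
  (1 - x ^ (n - 1)) * min 1 ((1 - y) / (1 - x)) + x ^ (n - 1) * (1 - y)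

/-- `F_p(θ) = p F(θ-) + (1 - p) F(θ)`. -/
def mixedCDF (F : ProbabilityMeasure ℝ) (p : I) (θ : ℝ) : ℝ :=
  (p : ℝ) * (F : Measure ℝ).real (Iio θ) + (1 - (p : ℝ)) * (F : Measure ℝ).real (Iic θ)

/-- The quantile function `F^←(t) = inf {z ≥ 0 : F(z) ≥ t}`, with values in `[0, ∞]`. -/
def quantile (F : ProbabilityMeasure ℝ) (t : ℝ) : ℝ≥0∞ :=
  ⨅ (z : ℝ≥0) (_ : t ≤ cdf (F : Measure ℝ) z), (z : ℝ≥0∞)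

/-- A distribution function as a map to `[0, 1]`. -/
def cdfMap (F : ProbabilityMeasure ℝ) (z : ℝ) : I :=
  ⟨cdf (F : Measure ℝ) z, cdf_nonneg _ _, cdf_le_one _ _⟩

/-- The Lebesgue–Stieltjes measure `dF^←` on `[0, 1]` of the left-continuous function `F^←`:
the measure without an atom at `1` that satisfies `dF^←([0, t)) = F^←(t)` for all `t`
(see `quantileMeasure_Iio` and `quantileMeasure_one`). It is the image under `F` of the Lebesgue
measure on `{z ≥ 0 : F(z) < 1}`. -/
def quantileMeasure (F : ProbabilityMeasure ℝ) : Measure I :=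
  ((volume : Measure ℝ).restrict {z | 0 ≤ z ∧ cdfMap F z < 1}).map (cdfMap F)

lemma cdfMap_mono (F : ProbabilityMeasure ℝ) : Monotone (cdfMap F) := fun _ _ h =>
  Subtype.mk_le_mk.2 (monotone_cdf _ h)

lemma quantileMeasure_one (F : ProbabilityMeasure ℝ) : quantileMeasure F {1} = 0 := by
  have hm := (cdfMap_mono F).measurable
  rw [quantileMeasure, Measure.map_apply hm (measurableSet_singleton _),
    Measure.restrict_apply (hm (measurableSet_singleton _))]
  convert measure_empty (μ := (volume : Measure ℝ))
  ext z
  simp +contextual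

lemma quantileMeasure_Iio (F : ProbabilityMeasure ℝ) (t : I) :
    quantileMeasure F (Iio t) = quantile F t := by
  have hm := (cdfMap_mono F).measurable
  rw [quantileMeasure, Measure.map_apply hm measurableSet_Iio,
    Measure.restrict_apply (hm measurableSet_Iio)]
  have hset : (cdfMap F ⁻¹' Iio t ∩ {z | 0 ≤ z ∧ cdfMap F z < 1} : Set ℝ)
      = {z : ℝ | 0 ≤ z ∧ ENNReal.ofReal z < quantile F t} := by
    ext z
    simp only [mem_inter_iff, mem_preimage, mem_Iio, mem_ofPred_eq]
    constructor
    · rintro ⟨h, hz, -⟩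
      refine ⟨hz, ?_⟩
      have hlt : cdf (F : Measure ℝ) z < t := h
      have hr := ((cdf (F : Measure ℝ)).right_continuous z).mono Ioi_subset_Ici_self
      have hev := (hr.tendsto.eventually (gt_mem_nhds hlt))
      obtain ⟨w, hw, hzw⟩ := (hev.and self_mem_nhdsWithin).exists
      have hzw' : z < w := hzw
      refine lt_of_lt_of_le
        ((ENNReal.ofReal_lt_ofReal_iff (lt_of_le_of_lt hz hzw')).2 hzw') ?_
      refine le_iInf₂ fun v hv => ?_
      rw [← ENNReal.ofReal_coe_nnreal]
      refine ENNReal.ofReal_le_ofReal ?_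
      by_contra hvw
      have := monotone_cdf (F : Measure ℝ) (not_le.1 hvw).le
      linarith
    · rintro ⟨hz, h⟩
      lift z to ℝ≥0 using hz
      rw [ENNReal.ofReal_coe_nnreal] at h
      have hlt : cdf (F : Measure ℝ) z < t := by
        by_contra hc
        have hle : quantile F t ≤ (z : ℝ≥0∞) :=
          (iInf_le _ z).trans (iInf_le _ (not_lt.1 hc))
        exact absurd (lt_of_lt_of_le h hle) (lt_irrefl _)
      exact ⟨hlt, z.2, Subtype.coe_lt_coe.1 (lt_of_lt_of_le hlt t.2.2)⟩
  rw [hset]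
  cases hq : quantile F t with
  | top =>
    have : {z : ℝ | 0 ≤ z ∧ ENNReal.ofReal z < ⊤} = Ici 0 := by ext z; simp
    rw [this]
    simp
  | coe a =>
    have : {z : ℝ | 0 ≤ z ∧ ENNReal.ofReal z < (a : ℝ≥0∞)} = Ico 0 (a : ℝ) := by
      ext z
      simp only [mem_ofPred_eq, mem_Ico]
      refine and_congr_right fun hz => ?_
      lift z to ℝ≥0 using hz
      rw [ENNReal.ofReal_coe_nnreal]
      simp
    rw [this]
    simp

end Prophet

end

open Prophet

noncomputable section

open Filter Topology

namespace Prophet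

/-! By the layer-cake formula, `M_n(F)` and the reward of a rule are integrals over `z > 0` of tail
probabilities, and at level `z` these depend on `z` only through `y = F(z)`. The maximum has tail `1
- y ^ n`. For a rule with rejection probability `x`, a sum over the time of first acceptance gives
the tail `W(x, y)`; the minimum appears because acceptance and `{X > z}` are nested events. Pushing
Lebesgue measure forward along `F` yields `dF^←`, so both values are linear in `dF^←` and the rule
enters only through `x` (`prophetValue_eq`, `reward_eq`).

Varying `θ` and `p` realizes every `x` in `[0, 1)`, and `x = 1` is recovered as a limit
(`exists_mixedCDF_eq`, `iSup_mixedCDF`). By Fubini, mixing over `x` gains nothing over the best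
single `x` (`iSup_mixed_eq`). Conversely, a measure on `[0, 1)` that is finite on each `[0, t)`, `t
< 1`, is `dF^←` for the law with quantile function `t ↦ ν [0, t)` (`quantileMeasure_quantileLaw`).

What remains is the atom of `μ` at `1`, which no `F` produces. In the ratio game it is moved to some
`s < 1` at the cost of a factor tending to `1` as `s ↑ 1` (`worstRatio_le_mul`). In the regret game
it is harmless because `A(x, 1) = 0`; it just stores the mass that `dF^←` lacks. -/

/-! ### The kernels -/

/-- A form of `rewardKernel` without division, valid for `x ≤ 1`. -/
lemma rewardKernel_eq (n : ℕ) {x y : ℝ} (hx : x ≤ 1) (hy : y ≤ 1) :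
    rewardKernel n x y =
      (∑ k ∈ Finset.range (n - 1), x ^ k) * min (1 - x) (1 - y) + x ^ (n - 1) * (1 - y) := by
  rw [rewardKernel]
  congr 1
  rcases hx.lt_or_eq with h | rfl
  · have h' : 0 < 1 - x := by linarith
    rw [← geom_sum_mul_neg, mul_assoc, mul_min_of_nonneg _ _ h'.le, mul_one,
      mul_div_cancel₀ _ h'.ne']
  · simp [hy]

lemma rewardKernel_nonneg (n : ℕ) {x y : ℝ} (hx0 : 0 ≤ x) (hx : x ≤ 1) (hy : y ≤ 1) :
    0 ≤ rewardKernel n x y := by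
  rw [rewardKernel_eq n hx hy]
  have h1 : 0 ≤ 1 - y := by linarith
  have h2 : 0 ≤ min (1 - x) (1 - y) := le_min (by linarith) h1
  positivity

/-- Replacing the minimum by `1 - y` loses nothing for `x ≤ y`. This sharpness near `y = 1` is what
later makes the cost of moving an atom away from `1` negligible. -/
lemma rewardKernel_le_geom (n : ℕ) [NeZero n] {x y : ℝ} (hx0 : 0 ≤ x) (hx : x ≤ 1)
    (hy : y ≤ 1) : rewardKernel n x y ≤ (∑ k ∈ Finset.range n, x ^ k) * (1 - y) := by
  obtain ⟨m, rfl⟩ := Nat.exists_eq_succ_of_ne_zero (NeZero.ne n)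
  rw [rewardKernel_eq _ hx hy, Finset.sum_range_succ, add_mul]
  simp only [Nat.succ_eq_add_one, Nat.add_sub_cancel]
  gcongr
  exact min_le_right _ _

lemma geom_le (n : ℕ) {x : ℝ} (hx0 : 0 ≤ x) (hx : x ≤ 1) :
    ∑ k ∈ Finset.range n, x ^ k ≤ n := by
  simpa using Finset.sum_le_card_nsmul (Finset.range n) (fun k => x ^ k) 1
    fun k _ => pow_le_one₀ hx0 hx

lemma rewardKernel_le (n : ℕ) [NeZero n] {x y : ℝ} (hx0 : 0 ≤ x) (hx : x ≤ 1)
    (hy : y ≤ 1) : rewardKernel n x y ≤ n * (1 - y) :=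
  (rewardKernel_le_geom n hx0 hx hy).trans
    (mul_le_mul_of_nonneg_right (geom_le n hx0 hx) (by linarith))

lemma rewardKernel_one_right (n : ℕ) {x : ℝ} (hx : x ≤ 1) : rewardKernel n x 1 = 0 := by
  simp [rewardKernel_eq n hx le_rfl, hx]

lemma one_sub_le_one_sub_pow (n : ℕ) [NeZero n] {y : ℝ} (hy0 : 0 ≤ y) (hy : y ≤ 1) :
    1 - y ≤ 1 - y ^ n := by
  have := pow_le_of_le_one hy0 hy (NeZero.ne n)
  linarith

lemma one_sub_pow_le (n : ℕ) {y : ℝ} (hy0 : 0 ≤ y) (hy : y ≤ 1) :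
    1 - y ^ n ≤ n * (1 - y) := by
  rw [← geom_sum_mul_neg]
  exact mul_le_mul_of_nonneg_right (geom_le n hy0 hy) (by linarith)

lemma one_sub_pow_pos (n : ℕ) [NeZero n] {y : ℝ} (hy0 : 0 ≤ y) (hy : y < 1) :
    0 < 1 - y ^ n :=
  lt_of_lt_of_le (by linarith) (one_sub_le_one_sub_pow n hy0 hy.le)

lemma kernelA_eq (n : ℕ) (x y : ℝ) : kernelA n x y = 1 - y ^ n - rewardKernel n x y := by
  rw [kernelA, rewardKernel]; ring

lemma kernelA_one_right (n : ℕ) {x : ℝ} (hx : x ≤ 1) : kernelA n x 1 = 0 := by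
  rw [kernelA_eq, rewardKernel_one_right n hx]; simp

lemma kernelR_of_lt (n : ℕ) (x : ℝ) {y : ℝ} (hy : y < 1) :
    kernelR n x y = rewardKernel n x y / (1 - y ^ n) := by
  rw [kernelR, if_pos hy, rewardKernel]; ring

lemma kernelR_one_right (n : ℕ) (x : ℝ) :
    kernelR n x 1 = (∑ k ∈ Finset.range n, x ^ k) / n := by
  simp [kernelR]

lemma kernelR_nonneg (n : ℕ) (x y : I) : 0 ≤ kernelR n x y := by
  rcases y.2.2.lt_or_eq with h | h
  · rw [kernelR_of_lt n _ h]
    exact div_nonneg (rewardKernel_nonneg n x.2.1 x.2.2 h.le)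
      (sub_nonneg.2 (pow_le_one₀ y.2.1 h.le))
  · rw [h, kernelR_one_right]
    have := x.2.1
    positivity

/-- `R(x, y) ≤ (∑ x ^ k) / (∑ y ^ k)`. -/
lemma kernelR_le_geom_div_geom (n : ℕ) [NeZero n] (x : I) {y : ℝ} (hy0 : 0 ≤ y) (hy : y < 1) :
    kernelR n x y ≤ (∑ k ∈ Finset.range n, (x : ℝ) ^ k) / ∑ k ∈ Finset.range n, y ^ k := by
  have h1 : 0 < 1 - y := by linarith
  have hpos := one_sub_pow_pos n hy0 hy
  have hg : 0 < ∑ k ∈ Finset.range n, y ^ k := by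
    rw [← geom_sum_mul_neg] at hpos
    exact pos_of_mul_pos_left hpos h1.le
  rw [kernelR_of_lt n _ hy, div_le_div_iff₀ hpos hg, ← geom_sum_mul_neg y n]
  calc _ ≤ ((∑ k ∈ Finset.range n, (x : ℝ) ^ k) * (1 - y)) * ∑ k ∈ Finset.range n, y ^ k := by
        gcongr
        exact rewardKernel_le_geom n x.2.1 x.2.2 hy.le
    _ = _ := by ring

lemma kernelR_le (n : ℕ) [NeZero n] (x y : I) : kernelR n x y ≤ n := by
  have hn : (1 : ℝ) ≤ n := by exact_mod_cast NeZero.one_le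
  rcases y.2.2.lt_or_eq with h | h
  · rw [kernelR_of_lt n _ h, div_le_iff₀ (one_sub_pow_pos n y.2.1 h)]
    exact (rewardKernel_le n x.2.1 x.2.2 h.le).trans
      (mul_le_mul_of_nonneg_left (one_sub_le_one_sub_pow n y.2.1 h.le) (by positivity))
  · rw [h, kernelR_one_right, div_le_iff₀ (by positivity)]
    have := geom_le n x.2.1 x.2.2
    nlinarith

lemma abs_kernelR_le (n : ℕ) [NeZero n] (x y : I) : |kernelR n x y| ≤ n := by
  rw [abs_of_nonneg (kernelR_nonneg n x y)]
  exact kernelR_le n x y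

lemma abs_kernelA_le (n : ℕ) [NeZero n] (x y : I) : |kernelA n x y| ≤ n := by
  have hn : (1 : ℝ) ≤ n := by exact_mod_cast NeZero.one_le
  have h1 := rewardKernel_nonneg n x.2.1 x.2.2 y.2.2
  have h2 := rewardKernel_le n x.2.1 x.2.2 y.2.2
  have h3 : 0 ≤ (y : ℝ) ^ n := pow_nonneg y.2.1 n
  have h4 : (y : ℝ) ^ n ≤ 1 := pow_le_one₀ y.2.1 y.2.2
  have h5 : 0 ≤ (n : ℝ) * y := mul_nonneg (by positivity) y.2.1
  rw [kernelA_eq, abs_le]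
  constructor <;> linarith

lemma measurable_rewardKernel (n : ℕ) : Measurable fun q : ℝ × ℝ => rewardKernel n q.1 q.2 := by
  unfold rewardKernel
  fun_prop

lemma measurable_kernelA (n : ℕ) : Measurable fun q : ℝ × ℝ => kernelA n q.1 q.2 := by
  unfold kernelA
  fun_prop

lemma measurable_kernelR (n : ℕ) : Measurable fun q : ℝ × ℝ => kernelR n q.1 q.2 := by
  unfold kernelR
  exact Measurable.ite (measurableSet_lt measurable_snd measurable_const) (by fun_prop)
    (by fun_prop)

/-! ### Mixed extensions -/

/-- After Fubini the mixed payoff is a `lam`-average over `x`, and some point does at least as well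
as the average. Point masses give the converse. Neither continuity nor compactness is involved. -/
lemma iSup_mixed_eq (k : ℝ → ℝ → ℝ) (hk : Measurable fun q : ℝ × ℝ => k q.1 q.2) (C : ℝ)
    (hC : ∀ x y : I, |k x y| ≤ C) (μ : ProbabilityMeasure I) :
    (⨆ lam : ProbabilityMeasure I,
      ((∫ y, ∫ x, k (x : ℝ) (y : ℝ) ∂(lam : Measure I) ∂(μ : Measure I) : ℝ) : EReal)) =
      ⨆ x : I, ((∫ y, k (x : ℝ) (y : ℝ) ∂(μ : Measure I) : ℝ) : EReal) := by
  have hm : Measurable fun q : I × I => k (q.2 : ℝ) (q.1 : ℝ) :=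
    hk.comp (by fun_prop : Measurable fun q : I × I => ((q.2 : ℝ), (q.1 : ℝ)))
  apply le_antisymm
  · refine iSup_le fun lam => ?_
    have hint : Integrable (fun q : I × I => k (q.2 : ℝ) (q.1 : ℝ))
        ((μ : Measure I).prod (lam : Measure I)) :=
      .of_bound hm.aestronglyMeasurable C (ae_of_all _ fun q => hC _ _)
    rw [integral_integral_swap hint]
    obtain ⟨x, hx⟩ := exists_integral_le hint.integral_prod_right
    exact le_iSup_of_le x (EReal.coe_le_coe_iff.2 hx)
  · refine iSup_le fun x => ?_
    refine le_iSup_of_le ⟨Measure.dirac x, inferInstance⟩ (le_of_eq ?_)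
    congr 1
    refine integral_congr_ae (ae_of_all _ fun y => ?_)
    simp

lemma iInf_mixed_eq (k : ℝ → ℝ → ℝ) (hk : Measurable fun q : ℝ × ℝ => k q.1 q.2) (C : ℝ)
    (hC : ∀ x y : I, |k x y| ≤ C) (μ : ProbabilityMeasure I) :
    (⨅ lam : ProbabilityMeasure I,
      ((∫ y, ∫ x, k (x : ℝ) (y : ℝ) ∂(lam : Measure I) ∂(μ : Measure I) : ℝ) : EReal)) =
      ⨅ x : I, ((∫ y, k (x : ℝ) (y : ℝ) ∂(μ : Measure I) : ℝ) : EReal) := by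
  have hm : Measurable fun q : I × I => k (q.2 : ℝ) (q.1 : ℝ) :=
    hk.comp (by fun_prop : Measurable fun q : I × I => ((q.2 : ℝ), (q.1 : ℝ)))
  apply le_antisymm
  · refine le_iInf fun x => ?_
    refine iInf_le_of_le ⟨Measure.dirac x, inferInstance⟩ (le_of_eq ?_)
    congr 1
    refine integral_congr_ae (ae_of_all _ fun y => ?_)
    simp
  · refine le_iInf fun lam => ?_
    have hint : Integrable (fun q : I × I => k (q.2 : ℝ) (q.1 : ℝ))
        ((μ : Measure I).prod (lam : Measure I)) :=
      .of_bound hm.aestronglyMeasurable C (ae_of_all _ fun q => hC _ _)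
    rw [integral_integral_swap hint]
    obtain ⟨x, hx⟩ := exists_le_integral hint.integral_prod_right
    exact iInf_le_of_le x (EReal.coe_le_coe_iff.2 hx)

lemma iSup_avgR (n : ℕ) [NeZero n] (μ : ProbabilityMeasure I) :
    (⨆ lam : ProbabilityMeasure I, ((avgR n lam μ : ℝ) : EReal)) =
      ⨆ x : I, ((∫ y : I, kernelR n x y ∂(μ : Measure I) : ℝ) : EReal) :=
  iSup_mixed_eq (kernelR n) (measurable_kernelR n) n (abs_kernelR_le n) μ

lemma iInf_avgA (n : ℕ) [NeZero n] (μ : ProbabilityMeasure I) :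
    (⨅ lam : ProbabilityMeasure I, ((avgA n lam μ : ℝ) : EReal)) =
      ⨅ x : I, ((∫ y : I, kernelA n x y ∂(μ : Measure I) : ℝ) : EReal) :=
  iInf_mixed_eq (kernelA n) (measurable_kernelA n) n (abs_kernelA_le n) μ

/-! ### Integration against `dF^←` -/

/-- Since `g` vanishes at `1`, the levels with `F(z) = 1`, left out of `quantileMeasure`, contribute
nothing. -/
lemma lintegral_quantileMeasure (F : ProbabilityMeasure ℝ) {g : I → ℝ≥0∞} (hg : Measurable g)
    (hg1 : g 1 = 0) :
    ∫⁻ y, g y ∂(quantileMeasure F) = ∫⁻ z in Ioi (0 : ℝ), g (cdfMap F z) := by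
  have hm := (cdfMap_mono F).measurable
  have hs : MeasurableSet {z : ℝ | 0 ≤ z ∧ cdfMap F z < 1} :=
    measurableSet_Ici.inter (hm measurableSet_Iio)
  rw [quantileMeasure, lintegral_map hg hm, Measure.restrict_congr_set Ioi_ae_eq_Ici,
    ← lintegral_indicator hs, ← lintegral_indicator measurableSet_Ici]
  refine lintegral_congr fun z => ?_
  by_cases hz : 0 ≤ z
  · by_cases h1 : cdfMap F z < 1
    · rw [indicator_of_mem (show z ∈ {z : ℝ | 0 ≤ z ∧ cdfMap F z < 1} from ⟨hz, h1⟩),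
        indicator_of_mem (show z ∈ Ici (0 : ℝ) from hz)]
    · rw [indicator_of_notMem (fun h => h1 h.2), indicator_of_mem (show z ∈ Ici (0 : ℝ) from hz),
        le_antisymm unitInterval.le_one' (not_lt.1 h1), hg1]
  · rw [indicator_of_notMem (fun h => hz h.1), indicator_of_notMem (show z ∉ Ici (0 : ℝ) from hz)]

/-- If `P (f > z) = g (F z)` for all `z > 0`, then `∫ f dP = ∫ g dF^←`. -/
lemma lintegral_eq_of_tail {Ω : Type*} [MeasurableSpace Ω] (P : Measure Ω)
    (F : ProbabilityMeasure ℝ) {f : Ω → ℝ} (hf : Measurable f) (hf0 : 0 ≤ᵐ[P] f) {g : I → ℝ}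
    (hg : Measurable g) (hg1 : g 1 = 0)
    (htail : ∀ z, 0 < z → P {ω | z < f ω} = ENNReal.ofReal (g (cdfMap F z))) :
    ∫⁻ ω, ENNReal.ofReal (f ω) ∂P = ∫⁻ y, ENNReal.ofReal (g y) ∂(quantileMeasure F) := by
  rw [lintegral_eq_lintegral_meas_lt P hf0 hf.aemeasurable,
    lintegral_quantileMeasure F hg.ennreal_ofReal (by simp [hg1])]
  exact setLIntegral_congr_fun measurableSet_Ioi fun z hz => htail z hz

/-- Both sides are `toReal` of the same lower integral, so no integrability is needed. -/
lemma integral_eq_of_tail {Ω : Type*} [MeasurableSpace Ω] (P : Measure Ω)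
    (F : ProbabilityMeasure ℝ) {f : Ω → ℝ} (hf : Measurable f) (hf0 : 0 ≤ᵐ[P] f) {g : I → ℝ}
    (hg : Measurable g) (hg1 : g 1 = 0) (hg0 : ∀ y, 0 ≤ g y)
    (htail : ∀ z, 0 < z → P {ω | z < f ω} = ENNReal.ofReal (g (cdfMap F z))) :
    ∫ ω, f ω ∂P = ∫ y, g y ∂(quantileMeasure F) := by
  rw [integral_eq_lintegral_of_nonneg_ae hf0 hf.aestronglyMeasurable,
    integral_eq_lintegral_of_nonneg_ae (ae_of_all _ hg0) hg.aestronglyMeasurable,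
    lintegral_eq_of_tail P F hf hf0 hg hg1 htail]

lemma real_Ioi (F : ProbabilityMeasure ℝ) (z : ℝ) : (F : Measure ℝ).real (Ioi z) = 1 - cdf (F : Measure ℝ) z := by
  rw [cdf_eq_real, ← probReal_compl_eq_one_sub measurableSet_Iic, compl_Iic]

lemma measure_Ioi_eq (F : ProbabilityMeasure ℝ) (z : ℝ) :
    (F : Measure ℝ) (Ioi z) = ENNReal.ofReal (1 - cdfMap F z) := by
  rw [← ofReal_measureReal, real_Ioi]
  rfl

lemma ae_nonneg {F : ProbabilityMeasure ℝ} (hF : (F : Measure ℝ) (Iio 0) = 0) :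
    ∀ᵐ x ∂(F : Measure ℝ), 0 ≤ x := by
  rw [ae_iff]
  simpa [not_le] using! hF

/-- Finite mean thus amounts to integrability of `1 - y` against `dF^←`, and `n * (1 - y)` dominates
both integrands of interest. -/
lemma lintegral_one_sub (F : ProbabilityMeasure ℝ) (hF : (F : Measure ℝ) (Iio 0) = 0) :
    ∫⁻ y : I, ENNReal.ofReal (1 - y) ∂(quantileMeasure F) =
      ∫⁻ x, ENNReal.ofReal x ∂(F : Measure ℝ) :=
  (lintegral_eq_of_tail (F : Measure ℝ) F measurable_id (ae_nonneg hF)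
    (g := fun y : I => 1 - (y : ℝ)) (by fun_prop) (by simp)
    fun z _ => measure_Ioi_eq F z).symm

lemma integrable_one_sub (F : ProbabilityMeasure ℝ) (hF : (F : Measure ℝ) (Iio 0) = 0)
    (hint : Integrable (fun x : ℝ => x) (F : Measure ℝ)) :
    Integrable (fun y : I => 1 - (y : ℝ)) (quantileMeasure F) := by
  rw [← lintegral_ofReal_ne_top_iff_integrable (by fun_prop)
    (ae_of_all _ fun y => sub_nonneg.2 y.2.2), lintegral_one_sub F hF]
  exact (lintegral_ofReal_ne_top_iff_integrable hint.1 (ae_nonneg hF)).2 hint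

lemma integrable_one_sub_pow (n : ℕ) (F : ProbabilityMeasure ℝ)
    (hF : (F : Measure ℝ) (Iio 0) = 0)
    (hint : Integrable (fun x : ℝ => x) (F : Measure ℝ)) :
    Integrable (fun y : I => 1 - (y : ℝ) ^ n) (quantileMeasure F) := by
  refine ((integrable_one_sub F hF hint).const_mul (n : ℝ)).mono' (by fun_prop)
    (ae_of_all _ fun y => ?_)
  rw [Real.norm_of_nonneg (sub_nonneg.2 (pow_le_one₀ y.2.1 y.2.2))]
  exact one_sub_pow_le n y.2.1 y.2.2

lemma measurable_rewardKernel_right (n : ℕ) (x : ℝ) :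
    Measurable fun y : I => rewardKernel n x y :=
  (measurable_rewardKernel n).comp (by fun_prop : Measurable fun y : I => (x, (y : ℝ)))

lemma integrable_rewardKernel (n : ℕ) [NeZero n] (F : ProbabilityMeasure ℝ)
    (hF : (F : Measure ℝ) (Iio 0) = 0)
    (hint : Integrable (fun x : ℝ => x) (F : Measure ℝ)) {x : ℝ} (hx0 : 0 ≤ x) (hx : x ≤ 1) :
    Integrable (fun y : I => rewardKernel n x y) (quantileMeasure F) := by
  refine ((integrable_one_sub F hF hint).const_mul (n : ℝ)).mono'
    (measurable_rewardKernel_right n x).aestronglyMeasurable (ae_of_all _ fun y => ?_)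
  rw [Real.norm_of_nonneg (rewardKernel_nonneg n hx0 hx y.2.2)]
  exact rewardKernel_le n hx0 hx y.2.2

/-! ### The prophet value -/

lemma prophetValue_eq (n : ℕ) [NeZero n] (F : ProbabilityMeasure ℝ)
    (hF : (F : Measure ℝ) (Iio 0) = 0) :
    prophetValue n F = ∫ y : I, (1 - (y : ℝ) ^ n) ∂(quantileMeasure F) := by
  have hset : ∀ z : ℝ, {X : Fin n → ℝ | z < ⨆ t, X t} = (univ.pi fun _ => Iic z)ᶜ := fun z => by
    ext X
    simp only [mem_ofPred_eq, mem_compl_iff, mem_univ_pi, mem_Iic, not_forall, not_le]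
    exact lt_ciSup_iff (Set.finite_range X).bddAbove
  have hms : ∀ z : ℝ, MeasurableSet (univ.pi fun _ => Iic z : Set (Fin n → ℝ)) := fun z =>
    .univ_pi fun _ => measurableSet_Iic
  refine integral_eq_of_tail _ F (f := fun X : Fin n → ℝ => ⨆ t, X t)
    (g := fun y : I => 1 - (y : ℝ) ^ n) (measurable_of_Ioi fun z => ?_) ?_ (by fun_prop) (by simp)
    (fun y => sub_nonneg.2 (pow_le_one₀ y.2.1 y.2.2)) fun z _ => ?_
  · change MeasurableSet {X : Fin n → ℝ | z < ⨆ t, X t}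
    rw [hset]
    exact (hms z).compl
  · have h0 : ∀ᵐ X : Fin n → ℝ ∂(Measure.pi fun _ => (F : Measure ℝ)), 0 ≤ X 0 :=
      (measurePreserving_eval (fun _ : Fin n => (F : Measure ℝ)) 0).quasiMeasurePreserving.ae
        (ae_nonneg hF)
    filter_upwards [h0] with X hX
    exact hX.trans (le_ciSup (Set.finite_range X).bddAbove 0)
  · have h1 : (Measure.pi fun _ : Fin n => (F : Measure ℝ)).real (univ.pi fun _ => Iic z) =
        (cdfMap F z : ℝ) ^ n := by
      rw [measureReal_def, Measure.pi_pi]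
      simp [measureReal_def, cdfMap, cdf_eq_real]
    rw [hset, ← ofReal_measureReal, probReal_compl_eq_one_sub (hms z), h1]

/-! ### First acceptance in an iid sample -/

open Classical in
lemma prod_first_acceptance {n : ℕ} (t : Fin n) (a b : ℝ) :
    ∏ s : Fin n, (if s < t then a else if s = t then b else 1) = a ^ (t : ℕ) * b := by
  have h : ∀ s : Fin n, (if s < t then a else if s = t then b else 1) =
      (if s < t then a else 1) * (if s = t then b else 1) := fun s => by
    split_ifs with h1 h2
    · exact absurd h2 h1.ne
    all_goals simp
  simp_rw [h, Finset.prod_mul_distrib]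
  rw [Finset.prod_ite_eq' Finset.univ t (fun _ => b), Finset.prod_ite]
  have : (Finset.univ.filter fun s : Fin n => s < t) = Finset.Iio t := by ext; simp
  simp [this]

open Classical in
/-- Rejection before `t`, acceptance at `t` unless `t` is the last time, and the event `C`
at `t`. -/
def firstAcceptBox {α : Type*} {n : ℕ} (B C : Set α) (t : Fin n) : Set (Fin n → α) :=
  univ.pi fun s => if s < t then Bᶜ else if s = t then
    (if (t : ℕ) + 1 < n then B ∩ C else C) else univ

lemma mem_firstAcceptBox {α : Type*} {n : ℕ} {B C : Set α} {t : Fin n} {ω : Fin n → α} :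
    ω ∈ firstAcceptBox B C t ↔
      (∀ s < t, ω s ∉ B) ∧ ω t ∈ C ∧ ((t : ℕ) + 1 < n → ω t ∈ B) := by
  simp only [firstAcceptBox, mem_univ_pi]
  constructor
  · intro h
    refine ⟨fun s hs => by simpa [hs] using h s, ?_⟩
    have := h t
    simp only [lt_irrefl, if_false, if_true] at this
    split_ifs at this with h1
    · exact ⟨this.2, fun _ => this.1⟩
    · exact ⟨this, fun h' => absurd h' h1⟩
  · rintro ⟨h1, h2, h3⟩ s
    split_ifs with hs hs' hn
    · exact h1 s hs
    · exact hs' ▸ ⟨h3 hn, h2⟩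
    · exact hs' ▸ h2
    · trivial

lemma measurableSet_firstAcceptBox {α : Type*} [MeasurableSpace α] {n : ℕ} {B C : Set α}
    (hB : MeasurableSet B) (hC : MeasurableSet C) (t : Fin n) :
    MeasurableSet (firstAcceptBox B C t) := by
  refine .univ_pi fun s => ?_
  split_ifs
  exacts [hB.compl, hB.inter hC, hC, .univ]

lemma disjoint_firstAcceptBox {α : Type*} {n : ℕ} (B C : Set α) :
    Pairwise (Function.onFun Disjoint (firstAcceptBox B C : Fin n → Set (Fin n → α))) := by
  have key : ∀ t t' : Fin n, t < t' →
      Disjoint (firstAcceptBox B C t) (firstAcceptBox B C t') := fun t t' h => by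
    rw [Set.disjoint_left]
    intro ω h1 h2
    rw [mem_firstAcceptBox] at h1 h2
    -- As `t < t'`, time `t` is not the last one, so the first box forces acceptance at `t` while
    -- the second forbids it.
    exact h2.1 t h (h1.2.2 (by have := t'.2; have : (t : ℕ) < t' := h; omega))
  intro t t' h
  rcases h.lt_or_gt with h | h
  exacts [key _ _ h, (key _ _ h).symm]

/-- By independence the box at time `t` has a factor `ρ Bᶜ` for each earlier time. The last time
stands apart, since stopping there does not require acceptance. -/
lemma measure_iUnion_firstAcceptBox {α : Type*} [MeasurableSpace α] (ρ : Measure α)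
    [IsProbabilityMeasure ρ] (n : ℕ) [NeZero n] {B C : Set α}
    (hB : MeasurableSet B) (hC : MeasurableSet C) :
    (Measure.pi fun _ : Fin n => ρ).real (⋃ t, firstAcceptBox B C t) =
      (∑ k ∈ Finset.range (n - 1), ρ.real Bᶜ ^ k) * ρ.real (B ∩ C) +
        ρ.real Bᶜ ^ (n - 1) * ρ.real C := by
  classical
  rw [measureReal_iUnion_fintype (disjoint_firstAcceptBox B C)
    (measurableSet_firstAcceptBox hB hC)]
  have h : ∀ t : Fin n, (Measure.pi fun _ : Fin n => ρ).real (firstAcceptBox B C t) =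
      ρ.real Bᶜ ^ (t : ℕ) * (if (t : ℕ) + 1 < n then ρ.real (B ∩ C) else ρ.real C) := fun t => by
    rw [← prod_first_acceptance, measureReal_def, firstAcceptBox, Measure.pi_pi,
      ENNReal.toReal_prod]
    refine Finset.prod_congr rfl fun s _ => ?_
    split_ifs <;> simp [measureReal_def]
  obtain ⟨m, rfl⟩ := Nat.exists_eq_succ_of_ne_zero (NeZero.ne n)
  simp_rw [h]
  rw [Fin.sum_univ_castSucc]
  simp [Finset.sum_mul, Finset.sum_range]

/-! ### The reward of a threshold rule -/

/-- The acceptance region of the rule with threshold `θ`. -/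
def acceptSet (θ : ℝ) : Set (ℝ × Bool) := {q | θ < q.1 ∨ (q.1 = θ ∧ q.2 = true)}

lemma acceptSet_eq (θ : ℝ) : acceptSet θ = Ioi θ ×ˢ univ ∪ {θ} ×ˢ {true} := by
  ext ⟨a, b⟩
  simp [acceptSet, or_comm]

lemma measurableSet_acceptSet (θ : ℝ) : MeasurableSet (acceptSet θ) := by
  rw [acceptSet_eq]
  exact (measurableSet_Ioi.prod .univ).union ((measurableSet_singleton _).prod
    (measurableSet_singleton _))

/-- The boxes with `C = univ` partition the sample space according to the stopping time;
disjointness identifies the index of any box containing `ω`. -/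
lemma mem_firstAcceptBox_stopTime (n : ℕ) [NeZero n] (θ : ℝ) (ω : Fin n → ℝ × Bool)
    (C : Set (ℝ × Bool)) :
    ω (stopTime n θ ω) ∈ C ↔ ω ∈ ⋃ t, firstAcceptBox (acceptSet θ) C t := by
  have hmem : ∀ t, t ∈ acceptTimes n θ ω ↔ (t : ℕ) + 1 < n ∧ ω t ∈ acceptSet θ := fun t => by
    simp [acceptTimes, acceptSet]
  have hτ : ω ∈ firstAcceptBox (acceptSet θ) univ (stopTime n θ ω) := by
    rw [mem_firstAcceptBox, stopTime]
    split_ifs with h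
    · refine ⟨fun s hs hsB => ?_, mem_univ _, fun _ => ((hmem _).1 (Finset.min'_mem _ h)).2⟩
      have hs' : s ∈ acceptTimes n θ ω := by
        have : (s : ℕ) < _ := hs
        exact (hmem s).2 ⟨by have := ((hmem _).1 (Finset.min'_mem _ h)).1; omega, hsB⟩
      exact absurd (Finset.min'_le _ _ hs') (not_le.2 hs)
    · refine ⟨fun s hs hsB => h ⟨s, (hmem s).2 ⟨?_, hsB⟩⟩, mem_univ _, fun h' => ?_⟩
      · have : (s : ℕ) < n - 1 := hs
        omega
      · simp only at h'
        omega
  rw [mem_iUnion]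
  constructor
  · intro h
    rw [mem_firstAcceptBox] at hτ
    exact ⟨_, mem_firstAcceptBox.2 ⟨hτ.1, h, hτ.2.2⟩⟩
  · rintro ⟨t, ht⟩
    rw [mem_firstAcceptBox] at ht
    by_cases h : stopTime n θ ω = t
    · exact h ▸ ht.2.1
    · exact absurd (mem_firstAcceptBox.2 ⟨ht.1, mem_univ _, ht.2.2⟩)
        (Set.disjoint_left.1 (disjoint_firstAcceptBox (acceptSet θ) univ h) hτ)

lemma mixedCDF_eq (F : ProbabilityMeasure ℝ) (p : I) (θ : ℝ) :
    mixedCDF F p θ = cdf (F : Measure ℝ) θ - p * (F : Measure ℝ).real {θ} := by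
  have : (F : Measure ℝ).real (Iic θ) = (F : Measure ℝ).real (Iio θ) + (F : Measure ℝ).real {θ} := by
    rw [← measureReal_union (by simp) (measurableSet_singleton _), Iio_union_right]
  rw [mixedCDF, cdf_eq_real, this]
  ring

lemma mixedCDF_nonneg (F : ProbabilityMeasure ℝ) (p : I) (θ : ℝ) : 0 ≤ mixedCDF F p θ := by
  have := p.2.1
  have := sub_nonneg.2 p.2.2
  rw [mixedCDF]
  positivity

lemma mixedCDF_le_cdf (F : ProbabilityMeasure ℝ) (p : I) (θ : ℝ) :
    mixedCDF F p θ ≤ cdf (F : Measure ℝ) θ := by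
  rw [mixedCDF_eq]
  have := mul_nonneg p.2.1 (measureReal_nonneg (μ := (F : Measure ℝ)) (s := {θ}))
  linarith

lemma mixedCDF_le_one (F : ProbabilityMeasure ℝ) (p : I) (θ : ℝ) : mixedCDF F p θ ≤ 1 :=
  (mixedCDF_le_cdf F p θ).trans (cdf_le_one _ _)

lemma cdf_le_mixedCDF (F : ProbabilityMeasure ℝ) (p : I) {z θ : ℝ} (h : z < θ) :
    cdf (F : Measure ℝ) z ≤ mixedCDF F p θ := by
  have h1 : cdf (F : Measure ℝ) z ≤ (F : Measure ℝ).real (Iio θ) := by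
    rw [cdf_eq_real]
    exact measureReal_mono (Iic_subset_Iio.2 h)
  have h2 : (F : Measure ℝ).real (Iio θ) ≤ (F : Measure ℝ).real (Iic θ) :=
    measureReal_mono Iio_subset_Iic_self
  rw [mixedCDF]
  nlinarith [p.2.2]

section Sample

variable (F : ProbabilityMeasure ℝ) (p : I)

lemma real_prod_univ (s : Set ℝ) :
    ((F : Measure ℝ).prod (bernoulliMeasure true false p)).real (s ×ˢ univ) =
      (F : Measure ℝ).real s := by
  rw [measureReal_prod_prod]
  simp

lemma real_acceptSet (θ : ℝ) :
    ((F : Measure ℝ).prod (bernoulliMeasure true false p)).real (acceptSet θ) =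
      1 - mixedCDF F p θ := by
  rw [acceptSet_eq, measureReal_union ?_ ((measurableSet_singleton _).prod
    (measurableSet_singleton _)), real_prod_univ, measureReal_prod_prod, real_Ioi, mixedCDF_eq,
    bernoulliMeasure_real_apply p (measurableSet_singleton _)]
  · simp
    ring
  · rw [Set.disjoint_left]
    rintro ⟨a, b⟩ ⟨h1, -⟩ ⟨h2, -⟩
    simp only [mem_Ioi, mem_singleton_iff] at h1 h2
    exact h1.ne' h2

lemma real_acceptSet_compl (θ : ℝ) :
    ((F : Measure ℝ).prod (bernoulliMeasure true false p)).real (acceptSet θ)ᶜ =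
      mixedCDF F p θ := by
  rw [probReal_compl_eq_one_sub (measurableSet_acceptSet θ), real_acceptSet]
  ring

/-- The two events are nested: if `θ ≤ z`, every value above `z` is accepted; if `z < θ`, every
accepted value exceeds `z`. -/
lemma real_acceptSet_inter (θ z : ℝ) :
    ((F : Measure ℝ).prod (bernoulliMeasure true false p)).real
      (acceptSet θ ∩ Ioi z ×ˢ univ) = min (1 - mixedCDF F p θ) (1 - cdf (F : Measure ℝ) z) := by
  rcases le_or_gt θ z with h | h
  · have : acceptSet θ ∩ Ioi z ×ˢ univ = Ioi z ×ˢ univ :=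
      inter_eq_right.2 fun q hq => Or.inl (h.trans_lt hq.1)
    rw [this, real_prod_univ, real_Ioi, min_eq_right]
    have := mixedCDF_le_cdf F p θ
    have := monotone_cdf (F : Measure ℝ) h
    linarith
  · have : acceptSet θ ∩ Ioi z ×ˢ univ = acceptSet θ := by
      refine inter_eq_left.2 fun q hq => ⟨?_, mem_univ _⟩
      rcases hq with hq | hq
      exacts [h.trans hq, hq.1 ▸ h]
    rw [this, real_acceptSet, min_eq_left]
    have := cdf_le_mixedCDF F p h
    linarith

end Sample

lemma reward_eq (n : ℕ) [NeZero n] (F : ProbabilityMeasure ℝ)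
    (hF : (F : Measure ℝ) (Iio 0) = 0) (θ : ℝ) (p : I) :
    reward n F θ p = ∫ y : I, rewardKernel n (mixedCDF F p θ) y ∂(quantileMeasure F) := by
  have hx0 := mixedCDF_nonneg F p θ
  have hx := mixedCDF_le_one F p θ
  have hset : ∀ z : ℝ, {ω : Fin n → ℝ × Bool | z < (ω (stopTime n θ ω)).1} =
      ⋃ t, firstAcceptBox (acceptSet θ) (Ioi z ×ˢ univ) t := fun z => by
    ext ω
    rw [← mem_firstAcceptBox_stopTime]
    simp
  have hmC : ∀ z : ℝ, MeasurableSet (Ioi z ×ˢ (univ : Set Bool)) := fun z =>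
    measurableSet_Ioi.prod .univ
  refine integral_eq_of_tail _ F (f := fun ω : Fin n → ℝ × Bool => (ω (stopTime n θ ω)).1)
    (measurable_of_Ioi fun z => ?_) ?_ (measurable_rewardKernel_right n _)
    (rewardKernel_one_right n hx) (fun y => rewardKernel_nonneg n hx0 hx y.2.2) fun z _ => ?_
  · change MeasurableSet {ω : Fin n → ℝ × Bool | z < (ω (stopTime n θ ω)).1}
    rw [hset]
    exact .iUnion fun t => measurableSet_firstAcceptBox (measurableSet_acceptSet θ)
      (hmC z) t
  · have h0 : ∀ᵐ ω ∂(sampleLaw n F p), ∀ t, 0 ≤ (ω t).1 := by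
      refine ae_all_iff.2 fun t => ?_
      have h1 := (measurePreserving_eval (fun _ : Fin n =>
        (F : Measure ℝ).prod (bernoulliMeasure true false p)) t).quasiMeasurePreserving
      exact h1.ae (Measure.quasiMeasurePreserving_fst.ae (ae_nonneg hF))
    filter_upwards [h0] with ω hω using hω _
  · rw [hset, sampleLaw, ← ofReal_measureReal, measure_iUnion_firstAcceptBox _ n
      (measurableSet_acceptSet θ) (hmC z), real_acceptSet_compl, real_acceptSet_inter,
      real_prod_univ, real_Ioi, rewardKernel_eq n hx (cdfMap F z).2.2]
    rfl

/-! ### The attained values of the mixed distribution function -/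

/-- Left continuity of `t ↦ ν (Iio t)`, by continuity from below. -/
lemma measure_Iio_le_of_forall_lt {α : Type*} [LinearOrder α] [TopologicalSpace α]
    [OrderTopology α] [DenselyOrdered α] [FirstCountableTopology α] [MeasurableSpace α]
    {ν : Measure α} {t : α} {c : ℝ≥0∞} (h : ∀ u < t, ν (Iio u) ≤ c) : ν (Iio t) ≤ c := by
  rcases (Iio t).eq_empty_or_nonempty with h0 | ⟨y, hy⟩
  · simp [h0]
  · obtain ⟨u, hu, hut, hlim⟩ := exists_seq_strictMono_tendsto' (show y < t from hy)
    have hU : Iio t = ⋃ k, Iio (u k) := by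
      ext z
      simp only [mem_Iio, mem_iUnion]
      exact ⟨fun hz => (hlim.eventually (lt_mem_nhds hz)).exists,
        fun ⟨k, hk⟩ => hk.trans (hut k).2⟩
    rw [hU]
    exact le_of_tendsto' (tendsto_measure_iUnion_atTop
      fun i j hij => Iio_subset_Iio (hu.monotone hij)) fun k => h _ (hut k).2

/-- Take `θ` to be the `x`-quantile. Then `F(θ-) ≤ x ≤ F(θ)`, and randomizing at the atom fills the
jump: `p` is the weight of `F(θ-)` in the convex combination equal to `x`. -/
lemma exists_mixedCDF_eq (F : ProbabilityMeasure ℝ) (hF : (F : Measure ℝ) (Iio 0) = 0) {x : ℝ}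
    (hx0 : 0 ≤ x) (hx : x < 1) : ∃ (θ : ℝ≥0) (p : I), mixedCDF F p θ = x := by
  set S : Set ℝ := {z | 0 ≤ z ∧ x ≤ cdf (F : Measure ℝ) z} with hS
  have hne : S.Nonempty :=
    (((tendsto_cdf_atTop (F : Measure ℝ)).eventually (le_mem_nhds hx)).and
      (eventually_ge_atTop 0)).exists.imp fun z hz => ⟨hz.2, hz.1⟩
  have hbdd : BddBelow S := ⟨0, fun z hz => hz.1⟩
  have hθ0 : 0 ≤ sInf S := le_csInf hne fun z hz => hz.1
  have hb : x ≤ (F : Measure ℝ).real (Iic (sInf S)) := by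
    rw [← cdf_eq_real]
    have hr : Tendsto (cdf (F : Measure ℝ)) (𝓝[>] (sInf S))
        (𝓝 (cdf (F : Measure ℝ) (sInf S))) :=
      (((cdf (F : Measure ℝ)).right_continuous _).mono Ioi_subset_Ici_self).tendsto
    refine ge_of_tendsto hr (eventually_nhdsWithin_of_forall fun w hw => ?_)
    obtain ⟨z, hz, hzw⟩ := exists_lt_of_csInf_lt hne hw
    exact hz.2.trans (monotone_cdf _ hzw.le)
  have ha : (F : Measure ℝ).real (Iio (sInf S)) ≤ x := by
    refine ENNReal.toReal_le_of_le_ofReal hx0 (measure_Iio_le_of_forall_lt fun u hu => ?_)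
    rcases lt_or_ge u 0 with h0 | h0
    · exact (measure_mono (Iio_subset_Iio h0.le)).trans (by simp [hF])
    · refine (measure_mono Iio_subset_Iic_self).trans ?_
      rw [← ofReal_cdf]
      exact ENNReal.ofReal_le_ofReal (le_of_not_ge fun h => notMem_of_lt_csInf hu hbdd ⟨h0, h⟩)
  obtain ⟨a, b, ha0, hb0, hab, hx'⟩ := (segment_eq_Icc (ha.trans hb)).symm ▸
    (show x ∈ Icc _ _ from ⟨ha, hb⟩)
  refine ⟨⟨sInf S, hθ0⟩, ⟨a, ha0, by linarith⟩, ?_⟩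
  obtain rfl : b = 1 - a := by linarith
  exact hx'

/-- The value `x = 1` need not be attained when `F` has unbounded support, hence the assumed left
limit at `1`. -/
lemma iSup_mixedCDF (F : ProbabilityMeasure ℝ) (hF : (F : Measure ℝ) (Iio 0) = 0)
    {h : ℝ → EReal} (hh : Tendsto h (𝓝[<] 1) (𝓝 (h 1))) :
    ⨆ (θ : ℝ≥0) (p : I), h (mixedCDF F p θ) = ⨆ x : I, h x := by
  have key : ∀ x : ℝ, 0 ≤ x → x < 1 → h x ≤ ⨆ (θ : ℝ≥0) (p : I), h (mixedCDF F p θ) := by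
    intro x hx0 hx
    obtain ⟨θ, p, rfl⟩ := exists_mixedCDF_eq F hF hx0 hx
    exact le_iSup₂ (f := fun (θ : ℝ≥0) (p : I) => h (mixedCDF F p θ)) θ p
  refine le_antisymm (iSup₂_le fun θ p => ?_) (iSup_le fun x => ?_)
  · exact le_iSup (fun x : I => h x) ⟨_, mixedCDF_nonneg F p θ, mixedCDF_le_one F p θ⟩
  · rcases x.2.2.lt_or_eq with hx | hx
    · exact key x x.2.1 hx
    · rw [hx]
      exact le_of_tendsto hh (mem_of_superset (Ioo_mem_nhdsLT one_pos) fun x hx => key x hx.1.le hx.2)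

lemma iInf_mixedCDF (F : ProbabilityMeasure ℝ) (hF : (F : Measure ℝ) (Iio 0) = 0)
    {h : ℝ → EReal} (hh : Tendsto h (𝓝[<] 1) (𝓝 (h 1))) :
    ⨅ (θ : ℝ≥0) (p : I), h (mixedCDF F p θ) = ⨅ x : I, h x := by
  have key : ∀ x : ℝ, 0 ≤ x → x < 1 → ⨅ (θ : ℝ≥0) (p : I), h (mixedCDF F p θ) ≤ h x := by
    intro x hx0 hx
    obtain ⟨θ, p, rfl⟩ := exists_mixedCDF_eq F hF hx0 hx
    exact iInf₂_le (f := fun (θ : ℝ≥0) (p : I) => h (mixedCDF F p θ)) θ p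
  refine le_antisymm (le_iInf fun x => ?_) (le_iInf₂ fun θ p => ?_)
  · rcases x.2.2.lt_or_eq with hx | hx
    · exact key x x.2.1 hx
    · rw [hx]
      exact ge_of_tendsto hh (mem_of_superset (Ioo_mem_nhdsLT one_pos) fun x hx => key x hx.1.le hx.2)
  · exact iInf_le (fun x : I => h x) ⟨_, mixedCDF_nonneg F p θ, mixedCDF_le_one F p θ⟩

lemma tendsto_rewardKernel (n : ℕ) {y : ℝ} (hy : y ≤ 1) :
    Tendsto (fun x => rewardKernel n x y) (𝓝[<] 1) (𝓝 (rewardKernel n 1 y)) := by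
  have hc : Continuous fun x : ℝ => (∑ k ∈ Finset.range (n - 1), x ^ k) * min (1 - x) (1 - y) +
      x ^ (n - 1) * (1 - y) := by fun_prop
  rw [rewardKernel_eq n le_rfl hy]
  refine (hc.continuousAt.tendsto.mono_left nhdsWithin_le_nhds).congr' ?_
  filter_upwards [self_mem_nhdsWithin] with x hx
  exact (rewardKernel_eq n (le_of_lt hx) hy).symm

lemma tendsto_integral_rewardKernel (n : ℕ) [NeZero n] (F : ProbabilityMeasure ℝ)
    (hF : (F : Measure ℝ) (Iio 0) = 0)
    (hint : Integrable (fun x : ℝ => x) (F : Measure ℝ)) :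
    Tendsto (fun x => ∫ y : I, rewardKernel n x y ∂(quantileMeasure F)) (𝓝[<] 1)
      (𝓝 (∫ y : I, rewardKernel n 1 y ∂(quantileMeasure F))) := by
  refine tendsto_integral_filter_of_dominated_convergence (fun y : I => n * (1 - (y : ℝ)))
    (.of_forall fun x => (measurable_rewardKernel_right n x).aestronglyMeasurable) ?_
    ((integrable_one_sub F hF hint).const_mul _)
    (ae_of_all _ fun y => tendsto_rewardKernel n y.2.2)
  filter_upwards [Ioo_mem_nhdsLT (one_pos : (0 : ℝ) < 1)] with x hx
  refine ae_of_all _ fun y => ?_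
  rw [Real.norm_of_nonneg (rewardKernel_nonneg n hx.1.le hx.2.le y.2.2)]
  exact rewardKernel_le n hx.1.le hx.2.le y.2.2

/-! ### Distributions with a prescribed quantile measure -/

/-- The total mass may be infinite, so the measures are compared on intervals `[0, u_k)` with `u_k ↑
1`, where they are finite and differences of initial segments make sense. -/
lemma ext_of_Iio_of_singleton_one {μ ν : Measure I} (hμ : μ {1} = 0) (hν : ν {1} = 0)
    (h : ∀ t, μ (Iio t) = ν (Iio t)) (hfin : ∀ t < 1, ν (Iio t) ≠ ∞) : μ = ν := by
  obtain ⟨u, hu, hu1, hlim⟩ := exists_seq_strictMono_tendsto' (zero_lt_one : (0 : I) < 1)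
  have hU : Iio 1 = ⋃ k, Iio (u k) := by
    ext z
    simp only [mem_Iio, mem_iUnion]
    exact ⟨fun hz => (hlim.eventually (lt_mem_nhds hz)).exists,
      fun ⟨k, hk⟩ => hk.trans (hu1 k).2⟩
  have hself : ∀ {ρ : Measure I}, ρ {1} = 0 → ρ.restrict (Iio 1) = ρ := fun {ρ} hρ => by
    refine Measure.restrict_eq_self_of_ae_mem ?_
    rw [ae_iff]
    convert hρ
    ext y
    simp only [mem_ofPred_eq, mem_Iio, not_lt, mem_singleton_iff]
    exact ⟨fun hy => le_antisymm unitInterval.le_one' hy, fun hy => hy.ge⟩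
  rw [← hself hμ, ← hself hν, hU, Measure.restrict_iUnion_congr]
  intro k
  have : IsFiniteMeasure (ν.restrict (Iio (u k))) :=
    ⟨by simpa using (hfin _ (hu1 k).2).lt_top⟩
  have : IsFiniteMeasure (μ.restrict (Iio (u k))) :=
    ⟨by simpa [h] using (hfin _ (hu1 k).2).lt_top⟩
  refine Measure.ext_of_Ici _ _ fun a => ?_
  have hd : ∀ ρ : Measure I, ρ (Iio (u k)) ≠ ∞ → ρ.restrict (Iio (u k)) (Ici a) =
      ρ (Iio (u k)) - ρ (Iio (min a (u k))) := fun ρ hρ => by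
    rw [Measure.restrict_apply measurableSet_Ici, ← measure_sdiff
      (Iio_subset_Iio (min_le_right _ _)) measurableSet_Iio.nullMeasurableSet
      (ne_top_of_le_ne_top hρ (measure_mono (Iio_subset_Iio (min_le_right _ _))))]
    congr 1
    ext z
    simp only [mem_inter_iff, mem_Ici, mem_Iio, Set.mem_sdiff, lt_min_iff, not_and, not_lt]
    exact ⟨fun hz => ⟨hz.2, fun h' => absurd h' (not_lt.2 hz.1)⟩,
      fun hz => ⟨not_lt.1 fun h' => absurd hz.1 (not_lt.2 (hz.2 h')), hz.1⟩⟩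
  rw [hd μ (by rw [h]; exact hfin _ (hu1 k).2), hd ν (hfin _ (hu1 k).2), h, h]

lemma measurable_measure_Iio (ν : Measure I) : Measurable fun u : I => (ν (Iio u)).toReal :=
  (Monotone.measurable fun _ _ h => measure_mono (Iio_subset_Iio h)).ennreal_toReal

/-- The distribution whose quantile function is `t ↦ ν [0, t)`. -/
def quantileLaw (ν : Measure I) : ProbabilityMeasure ℝ :=
  ⟨(volume : Measure I).map fun u => (ν (Iio u)).toReal,
    Measure.isProbabilityMeasure_map (measurable_measure_Iio ν).aemeasurable⟩

lemma quantileLaw_apply (ν : Measure I) {s : Set ℝ} (hs : MeasurableSet s) :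
    (quantileLaw ν : Measure ℝ) s = volume {u : I | (ν (Iio u)).toReal ∈ s} :=
  Measure.map_apply (measurable_measure_Iio ν) hs

lemma quantileLaw_Iio_zero (ν : Measure I) : (quantileLaw ν : Measure ℝ) (Iio 0) = 0 := by
  rw [quantileLaw_apply ν measurableSet_Iio]
  convert measure_empty (μ := (volume : Measure I))
  ext u
  simp

lemma ofReal_cdf_quantileLaw (ν : Measure I) (z : ℝ) :
    ENNReal.ofReal (cdf (quantileLaw ν : Measure ℝ) z) =
      volume {u : I | (ν (Iio u)).toReal ≤ z} := by
  rw [ofReal_cdf, quantileLaw_apply ν measurableSet_Iic]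
  rfl

/-- For `≤`, monotonicity puts all of `[0, t)` into the event defining the distribution function at
`ν [0, t)`. For `≥`, if `z < ν [0, u)` with `u < t`, that event at level `z` lies in `[0, u)` up to
a null set, so `F(z) ≤ u < t`. -/
lemma quantile_quantileLaw (ν : Measure I) (hfin : ∀ t < 1, ν (Iio t) ≠ ∞) (t : I) :
    quantile (quantileLaw ν) t = ν (Iio t) := by
  apply le_antisymm
  · by_cases ht : ν (Iio t) = ∞
    · simp [ht]
    · have hz : (t : ℝ) ≤ cdf (quantileLaw ν : Measure ℝ) ((ν (Iio t)).toNNReal : ℝ) := by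
        rw [← ENNReal.ofReal_le_ofReal_iff (cdf_nonneg _ _), ofReal_cdf_quantileLaw,
          ← unitInterval.volume_Iio]
        exact measure_mono fun u hu =>
          ENNReal.toReal_mono ht (measure_mono (Iio_subset_Iio (le_of_lt hu)))
      refine (iInf₂_le (f := fun (z : ℝ≥0) (_ : (t : ℝ) ≤ cdf (quantileLaw ν : Measure ℝ) z) =>
        (z : ℝ≥0∞)) _ hz).trans ?_
      rw [ENNReal.coe_toNNReal ht]
  · refine le_iInf₂ fun z hz => measure_Iio_le_of_forall_lt fun u hu => not_lt.1 fun hlt => ?_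
    -- The point `1` is set apart because `ν (Iio 1)` may be infinite, and `toReal` would then be
    -- `0`.
    have hsub : {w : I | (ν (Iio w)).toReal ≤ z} ⊆ Iio u ∪ {1} := by
      intro w hw
      by_contra hw'
      simp only [union_singleton, mem_insert_iff, mem_Iio, not_or, not_lt] at hw'
      have hw1 : w < 1 := lt_of_le_of_ne unitInterval.le_one' hw'.1
      have h1 : ν (Iio w) ≤ z := by
        rw [← ENNReal.ofReal_toReal (hfin w hw1), ← ENNReal.ofReal_coe_nnreal]
        exact ENNReal.ofReal_le_ofReal hw
      exact absurd (hlt.trans_le ((measure_mono (Iio_subset_Iio hw'.2)).trans h1)) (lt_irrefl _)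
    have hle : ENNReal.ofReal t ≤ ENNReal.ofReal u := by
      calc ENNReal.ofReal t ≤ ENNReal.ofReal (cdf (quantileLaw ν : Measure ℝ) z) :=
            ENNReal.ofReal_le_ofReal hz
        _ ≤ volume (Iio u ∪ {1}) := by
            rw [ofReal_cdf_quantileLaw]
            exact measure_mono hsub
        _ ≤ volume (Iio u) + volume {1} := measure_union_le _ _
        _ = ENNReal.ofReal u := by simp [unitInterval.volume_Iio]
    rw [ENNReal.ofReal_le_ofReal_iff u.2.1] at hle
    exact absurd hu (not_lt.2 hle)

lemma quantileMeasure_quantileLaw (ν : Measure I) (hν : ν {1} = 0)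
    (hfin : ∀ t < 1, ν (Iio t) ≠ ∞) : quantileMeasure (quantileLaw ν) = ν :=
  ext_of_Iio_of_singleton_one (quantileMeasure_one _) hν
    (fun t => by rw [quantileMeasure_Iio, quantile_quantileLaw ν hfin]) hfin

/-! ### The ratio game -/

lemma ofReal_prophetValue (n : ℕ) [NeZero n] (F : ProbabilityMeasure ℝ)
    (hF : (F : Measure ℝ) (Iio 0) = 0)
    (hint : Integrable (fun x : ℝ => x) (F : Measure ℝ)) :
    ENNReal.ofReal (prophetValue n F) =
      ∫⁻ y : I, ENNReal.ofReal (1 - (y : ℝ) ^ n) ∂(quantileMeasure F) := by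
  rw [prophetValue_eq n F hF, ofReal_integral_eq_lintegral_ofReal
    (integrable_one_sub_pow n F hF hint)
    (ae_of_all _ fun y => sub_nonneg.2 (pow_le_one₀ y.2.1 y.2.2))]

/-- The prophet value is at least the mean, by `1 - y ≤ 1 - y ^ n`, and the mean is positive. -/
lemma prophetValue_pos (n : ℕ) [NeZero n] {F : ProbabilityMeasure ℝ} (hF : F ∈ distNonneg) :
    0 < prophetValue n F := by
  rw [← ENNReal.ofReal_pos, ofReal_prophetValue n F hF.1 hF.2.1]
  refine lt_of_lt_of_le ?_ (lintegral_mono fun y : I =>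
    ENNReal.ofReal_le_ofReal (one_sub_le_one_sub_pow n y.2.1 y.2.2))
  rw [lintegral_one_sub F hF.1, pos_iff_ne_zero]
  intro h
  rw [lintegral_eq_zero_iff (by fun_prop)] at h
  refine hF.2.2 (measure_mono_null (fun x hx => ?_) (ae_iff.1 h))
  simpa using hx

lemma ae_quantileMeasure_lt_one (F : ProbabilityMeasure ℝ) :
    ∀ᵐ y ∂(quantileMeasure F), y < 1 := by
  rw [ae_iff]
  convert quantileMeasure_one F
  ext y
  simp only [mem_ofPred_eq, not_lt, mem_singleton_iff]
  exact ⟨fun hy => le_antisymm unitInterval.le_one' hy, fun hy => hy.ge⟩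

/-- The measure `M_n(F)⁻¹ (1 - y ^ n) dF^←`. -/
def ratioMeasure (n : ℕ) (F : ProbabilityMeasure ℝ) : Measure I :=
  (ENNReal.ofReal (prophetValue n F))⁻¹ •
    (quantileMeasure F).withDensity (fun y => ENNReal.ofReal (1 - (y : ℝ) ^ n))

lemma isProbabilityMeasure_ratioMeasure (n : ℕ) [NeZero n] {F : ProbabilityMeasure ℝ}
    (hF : F ∈ distNonneg) : IsProbabilityMeasure (ratioMeasure n F) := by
  refine ⟨?_⟩
  rw [ratioMeasure, Measure.smul_apply, withDensity_apply _ .univ, Measure.restrict_univ,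
    ← ofReal_prophetValue n F hF.1 hF.2.1, smul_eq_mul, ENNReal.inv_mul_cancel
    (ENNReal.ofReal_pos.2 (prophetValue_pos n hF)).ne' ENNReal.ofReal_ne_top]

lemma integral_kernelR_ratioMeasure (n : ℕ) [NeZero n] {F : ProbabilityMeasure ℝ}
    (hF : F ∈ distNonneg) (x : ℝ) :
    ∫ y : I, kernelR n x y ∂(ratioMeasure n F) =
      (∫ y : I, rewardKernel n x y ∂(quantileMeasure F)) / prophetValue n F := by
  rw [ratioMeasure, integral_smul_measure, integral_withDensity_eq_integral_toReal_smul
    (by fun_prop) (ae_of_all _ fun y => ENNReal.ofReal_lt_top), ENNReal.toReal_inv,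
    ENNReal.toReal_ofReal (prophetValue_pos n hF).le, smul_eq_mul, div_eq_inv_mul]
  congr 1
  refine integral_congr_ae ?_
  filter_upwards [ae_quantileMeasure_lt_one F] with y hy
  have hpos := one_sub_pow_pos n y.2.1 (show (y : ℝ) < 1 from hy)
  rw [ENNReal.toReal_ofReal hpos.le, kernelR_of_lt n x (show (y : ℝ) < 1 from hy), smul_eq_mul,
    mul_div_cancel₀ _ hpos.ne']

lemma optRatio_eq (n : ℕ) [NeZero n] {F : ProbabilityMeasure ℝ} (hF : F ∈ distNonneg)
    (μ : ProbabilityMeasure I) (hμ : (μ : Measure I) = ratioMeasure n F) :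
    optRatio n F = ⨆ lam : ProbabilityMeasure I, ((avgR n lam μ : ℝ) : EReal) := by
  rw [iSup_avgR, optRatio]
  simp_rw [hμ, integral_kernelR_ratioMeasure n hF, reward_eq n F hF.1]
  refine iSup_mixedCDF F hF.1 (h := fun x => (((∫ y : I, rewardKernel n x y ∂(quantileMeasure F))
    / prophetValue n F : ℝ) : EReal)) ?_
  exact (continuous_coe_real_ereal.tendsto _).comp
    ((tendsto_integral_rewardKernel n F hF.1 hF.2.1).div_const _)

lemma quantileLaw_mem_distNonneg (n : ℕ) [NeZero n] {ν : Measure I} (hν1 : ν {1} = 0)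
    (hfin : ∀ t < 1, ν (Iio t) ≠ ∞) (hone : ∫⁻ y : I, ENNReal.ofReal (1 - (y : ℝ) ^ n) ∂ν = 1) :
    quantileLaw ν ∈ distNonneg ∧ prophetValue n (quantileLaw ν) = 1 := by
  have hq := quantileMeasure_quantileLaw ν hν1 hfin
  have hF := quantileLaw_Iio_zero ν
  have hint : Integrable (fun x : ℝ => x) (quantileLaw ν : Measure ℝ) := by
    rw [← lintegral_ofReal_ne_top_iff_integrable (by fun_prop) (ae_nonneg hF),
      ← lintegral_one_sub _ hF, hq]
    refine ne_top_of_le_ne_top ENNReal.one_ne_top (le_trans (lintegral_mono fun y : I =>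
      ENNReal.ofReal_le_ofReal (one_sub_le_one_sub_pow n y.2.1 y.2.2)) hone.le)
  have hM : ENNReal.ofReal (prophetValue n (quantileLaw ν)) = 1 := by
    rw [ofReal_prophetValue n _ hF hint, hq, hone]
  refine ⟨⟨hF, hint, fun h0 => ?_⟩, ENNReal.ofReal_eq_one.1 hM⟩
  have hz : ∫⁻ x, ENNReal.ofReal x ∂(quantileLaw ν : Measure ℝ) = 0 := by
    rw [lintegral_eq_zero_iff (by fun_prop), EventuallyEq, ae_iff]
    refine measure_mono_null (fun x hx => ?_) h0
    simpa using hx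
  -- A zero mean would concentrate `ν` at `y = 1`, where `1 - y ^ n` vanishes, against `hone`.
  rw [← lintegral_one_sub _ hF, hq, lintegral_eq_zero_iff (by fun_prop)] at hz
  refine one_ne_zero (hone.symm.trans ?_)
  rw [lintegral_eq_zero_iff (by fun_prop)]
  filter_upwards [hz] with y hy
  have h1 : (1 : ℝ) ≤ y := by simpa using hy
  simp [le_antisymm y.2.2 h1]

lemma withDensity_inv_Iio_ne_top (n : ℕ) [NeZero n] (μ : Measure I) [IsFiniteMeasure μ] {t : I}
    (ht : t < 1) :
    μ.withDensity (fun y : I => ENNReal.ofReal (1 - (y : ℝ) ^ n))⁻¹ (Iio t) ≠ ∞ := by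
  have hdt : 0 < ENNReal.ofReal (1 - (t : ℝ) ^ n) :=
    ENNReal.ofReal_pos.2 (one_sub_pow_pos n t.2.1 ht)
  rw [withDensity_apply _ measurableSet_Iio]
  refine (lt_of_le_of_lt (setLIntegral_mono' (g := fun _ => (ENNReal.ofReal (1 - (t : ℝ) ^ n))⁻¹)
    measurableSet_Iio fun y hy => ?_) ?_).ne
  · refine ENNReal.inv_le_inv.2 (ENNReal.ofReal_le_ofReal ?_)
    have : (y : ℝ) ^ n ≤ (t : ℝ) ^ n := pow_le_pow_left₀ y.2.1 (le_of_lt hy) n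
    linarith
  · rw [setLIntegral_const]
    exact ENNReal.mul_lt_top (ENNReal.inv_lt_top.2 hdt) (measure_lt_top _ _)

/-- The two densities cancel wherever `1 - y ^ n ≠ 0`, that is, off the `μ`-null point `1`. -/
lemma withDensity_inv_withDensity (n : ℕ) [NeZero n] {μ : Measure I} (hμ : μ {1} = 0) :
    (μ.withDensity (fun y : I => ENNReal.ofReal (1 - (y : ℝ) ^ n))⁻¹).withDensity
      (fun y : I => ENNReal.ofReal (1 - (y : ℝ) ^ n)) = μ := by
  have hm : Measurable fun y : I => ENNReal.ofReal (1 - (y : ℝ) ^ n) := by fun_prop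
  have key := withDensity_inv_same (μ := μ) hm.inv
    (ae_of_all _ fun y => ENNReal.inv_ne_zero.2 ENNReal.ofReal_ne_top) ?_
  · simpa only [Pi.inv_apply, inv_inv] using key
  simp only [Pi.inv_apply, ne_eq, ENNReal.inv_eq_top]
  rw [ae_iff]
  refine measure_mono_null (fun y hy => ?_) hμ
  by_contra h
  have : (y : ℝ) < 1 := lt_of_le_of_ne y.2.2 fun h' => h (Subtype.ext h')
  exact hy (ENNReal.ofReal_pos.2 (one_sub_pow_pos n y.2.1 this)).ne'

/-- Every probability measure without an atom at `1` arises in the ratio game. -/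
lemma exists_distNonneg_of_measure (n : ℕ) [NeZero n] (μ : ProbabilityMeasure I)
    (hμ : (μ : Measure I) {1} = 0) :
    ∃ F ∈ distNonneg, prophetValue n F = 1 ∧
      (μ : Measure I) =
        (quantileMeasure F).withDensity (fun y => ENNReal.ofReal (1 - (y : ℝ) ^ n)) := by
  obtain ⟨ν, hν⟩ : ∃ ν, ν = (μ : Measure I).withDensity
    (fun y : I => ENNReal.ofReal (1 - (y : ℝ) ^ n))⁻¹ := ⟨_, rfl⟩
  have hνμ : ν.withDensity (fun y : I => ENNReal.ofReal (1 - (y : ℝ) ^ n)) = μ := by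
    rw [hν]
    exact withDensity_inv_withDensity n hμ
  have hν1 : ν {1} = 0 := by
    rw [hν]
    exact withDensity_absolutelyContinuous _ _ hμ
  have hfin : ∀ t < 1, ν (Iio t) ≠ ∞ := fun t ht => by
    rw [hν]
    exact withDensity_inv_Iio_ne_top n _ ht
  have hone : ∫⁻ y : I, ENNReal.ofReal (1 - (y : ℝ) ^ n) ∂ν = 1 := by
    rw [← setLIntegral_univ, ← withDensity_apply _ .univ, hνμ, measure_univ]
  obtain ⟨hF, hM⟩ := quantileLaw_mem_distNonneg n hν1 hfin hone
  exact ⟨quantileLaw ν, hF, hM, by rw [quantileMeasure_quantileLaw ν hν1 hfin, hνμ]⟩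

/-- Moving an atom at `1` to `s < 1` increases the payoffs by at most the factor
`n / ∑ s ^ k`. -/
lemma worstRatio_le_mul (n : ℕ) [NeZero n] (μ : ProbabilityMeasure I) {c s : ℝ}
    (hc : ∀ x : I, ∫ y : I, kernelR n x y ∂(μ : Measure I) ≤ c) (hs0 : 0 ≤ s) (hs : s < 1) :
    worstRatio n ≤ ((n / (∑ k ∈ Finset.range n, s ^ k) * c : ℝ) : EReal) := by
  classical
  set φ : I → I := fun y => if y = 1 then ⟨s, hs0, hs.le⟩ else y with hφ
  have hφm : Measurable φ := Measurable.ite (measurableSet_singleton _) measurable_const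
    measurable_id
  have hφ1 : ∀ y, φ y ≠ 1 := fun y => by
    by_cases h : y = 1
    · simp only [hφ, h, if_true]
      exact fun h' => hs.ne (congrArg Subtype.val h')
    · simp [hφ, h]
  set ν : ProbabilityMeasure I :=
    ⟨(μ : Measure I).map φ, Measure.isProbabilityMeasure_map hφm.aemeasurable⟩ with hν
  have hν1 : (ν : Measure I) {1} = 0 := by
    change (μ : Measure I).map φ {1} = 0
    rw [Measure.map_apply hφm (measurableSet_singleton _)]
    convert measure_empty (μ := (μ : Measure I))
    ext y
    simpa using hφ1 y
  obtain ⟨F, hF, hM, hFν⟩ := exists_distNonneg_of_measure n ν hν1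
  have hr : (ν : Measure I) = ratioMeasure n F := by
    rw [ratioMeasure, hM, ← hFν]
    simp
  refine (iInf₂_le (f := fun F (_ : F ∈ distNonneg) => optRatio n F) F hF).trans ?_
  rw [optRatio_eq n hF ν hr, iSup_avgR]
  refine iSup_le fun x => EReal.coe_le_coe_iff.2 ?_
  have hmx : Measurable fun y : I => kernelR n x y :=
    (measurable_kernelR n).comp (by fun_prop : Measurable fun y : I => ((x : ℝ), (y : ℝ)))
  have hn : (0 : ℝ) < n := by exact_mod_cast NeZero.pos n
  have hg : 0 < ∑ k ∈ Finset.range n, s ^ k := by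
    have hpos := one_sub_pow_pos n hs0 hs
    rw [← geom_sum_mul_neg] at hpos
    exact pos_of_mul_pos_left hpos (by linarith)
  have hfac : 1 ≤ n / ∑ k ∈ Finset.range n, s ^ k := (one_le_div hg).2 (geom_le n hs0 hs.le)
  have hi : ∀ ψ : I → I, Measurable ψ →
      Integrable (fun y : I => kernelR n x (ψ y)) (μ : Measure I) := fun ψ hψ =>
    .of_bound (hmx.comp hψ).aestronglyMeasurable n (ae_of_all _ fun y => abs_kernelR_le n x (ψ y))
  change ∫ y : I, kernelR n x y ∂((μ : Measure I).map φ) ≤ _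
  rw [integral_map hφm.aemeasurable hmx.aestronglyMeasurable]
  calc ∫ y : I, kernelR n x (φ y) ∂(μ : Measure I)
      ≤ ∫ y : I, n / (∑ k ∈ Finset.range n, s ^ k) * kernelR n x y ∂(μ : Measure I) := by
        refine integral_mono (hi φ hφm) ((hi id measurable_id).const_mul _) fun y => ?_
        -- At `y = 1` the bound is `R(x, s) ≤ (∑ x ^ k) / (∑ s ^ k)`, which is the factor times
        -- `R(x, 1)`. Elsewhere the kernel is unchanged and nonnegative, and the factor is at least
        -- `1`.
        by_cases h : y = 1
        · simp only [hφ, h, if_true, Icc.coe_one]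
          refine (kernelR_le_geom_div_geom n x hs0 hs).trans (le_of_eq ?_)
          rw [kernelR_one_right]
          field_simp
        · simp only [hφ, h, if_false]
          exact le_mul_of_one_le_left (kernelR_nonneg n x y) hfac
    _ = n / (∑ k ∈ Finset.range n, s ^ k) * ∫ y : I, kernelR n x y ∂(μ : Measure I) :=
        integral_const_mul _ _
    _ ≤ _ := mul_le_mul_of_nonneg_left (hc x) (by positivity)

lemma worstRatio_eq (n : ℕ) [NeZero n] :
    worstRatio n = ⨅ μ : ProbabilityMeasure I, ⨆ lam : ProbabilityMeasure I,
      ((avgR n lam μ : ℝ) : EReal) := by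
  apply le_antisymm
  · refine le_iInf fun μ => ?_
    rw [iSup_avgR]
    obtain ⟨S, hS⟩ : ∃ S : EReal,
      S = ⨆ x : I, ((∫ y : I, kernelR n x y ∂(μ : Measure I) : ℝ) : EReal) := ⟨_, rfl⟩
    have hub : ∀ x : I, ((∫ y : I, kernelR n x y ∂(μ : Measure I) : ℝ) : EReal) ≤ S :=
      fun x => hS ▸ le_iSup (fun x : I => ((∫ y : I, kernelR n x y ∂(μ : Measure I) : ℝ) : EReal)) x
    rw [← hS]
    rcases eq_or_ne S ⊤ with h | htop
    · rw [h]
      exact le_top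
    have hbot : S ≠ ⊥ := ((EReal.bot_lt_coe _).trans_le (hub 0)).ne'
    clear hS
    lift S to ℝ using ⟨htop, hbot⟩
    have hc : Continuous fun s : ℝ => ∑ k ∈ Finset.range n, s ^ k := by fun_prop
    have hn : (n : ℝ) ≠ 0 := NeZero.ne _
    -- The atom is moved back towards `1`; the factor tends to `n / n = 1`.
    have hlim : Tendsto (fun s : ℝ => n / (∑ k ∈ Finset.range n, s ^ k) * S) (𝓝[<] 1) (𝓝 S) := by
      have h1 := ((tendsto_const_nhds (x := (n : ℝ))).div (hc.tendsto 1) (by simpa using hn)).mul_const S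
      have h2 : (n : ℝ) / (∑ k ∈ Finset.range n, (1 : ℝ) ^ k) * S = S := by simp [hn]
      rw [h2] at h1
      exact h1.mono_left nhdsWithin_le_nhds
    refine ge_of_tendsto ((continuous_coe_real_ereal.tendsto _).comp hlim) ?_
    filter_upwards [Ioo_mem_nhdsLT (one_pos : (0 : ℝ) < 1)] with s hs
    exact worstRatio_le_mul n μ (fun x => EReal.coe_le_coe_iff.1 (hub x)) hs.1.le hs.2
  · refine le_iInf₂ fun F hF => ?_
    rw [optRatio_eq n hF ⟨_, isProbabilityMeasure_ratioMeasure n hF⟩ rfl]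
    exact iInf_le _ _

/-! ### The regret game -/

lemma distUnit_Iio {F : ProbabilityMeasure ℝ} (hF : F ∈ distUnit) :
    (F : Measure ℝ) (Iio 0) = 0 :=
  measure_mono_null (show Iio (0 : ℝ) ⊆ (Icc 0 1)ᶜ from fun _ hx h => absurd h.1 (not_le.2 hx)) hF

lemma distUnit_integrable {F : ProbabilityMeasure ℝ} (hF : F ∈ distUnit) :
    Integrable (fun x : ℝ => x) (F : Measure ℝ) := by
  refine .of_bound (by fun_prop) 1 ?_
  have h : ∀ᵐ x ∂(F : Measure ℝ), x ∈ Icc (0 : ℝ) 1 := ae_iff.2 hF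
  filter_upwards [h] with x hx
  rw [Real.norm_of_nonneg hx.1]
  exact hx.2

lemma integral_kernelA_eq (n : ℕ) [NeZero n] {F : ProbabilityMeasure ℝ} (hF : F ∈ distUnit)
    (μ : ProbabilityMeasure I) (hμ : (μ : Measure I).restrict (Iio 1) = quantileMeasure F)
    {x : ℝ} (hx0 : 0 ≤ x) (hx : x ≤ 1) :
    ∫ y : I, kernelA n x y ∂(μ : Measure I) =
      prophetValue n F - ∫ y : I, rewardKernel n x y ∂(quantileMeasure F) := by
  have h0 := distUnit_Iio hF
  have hi := distUnit_integrable hF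
  rw [prophetValue_eq n F h0, ← integral_sub (integrable_one_sub_pow n F h0 hi)
    (integrable_rewardKernel n F h0 hi hx0 hx)]
  simp_rw [← kernelA_eq, ← hμ]
  -- The kernel vanishes at `y = 1`, so the atom of `μ` there is invisible.
  refine (setIntegral_eq_integral_of_forall_compl_eq_zero fun y hy => ?_).symm
  rw [le_antisymm unitInterval.le_one' (not_lt.1 hy), Icc.coe_one, kernelA_one_right n hx]

lemma optRegret_eq (n : ℕ) [NeZero n] {F : ProbabilityMeasure ℝ} (hF : F ∈ distUnit)
    (μ : ProbabilityMeasure I) (hμ : (μ : Measure I).restrict (Iio 1) = quantileMeasure F) :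
    optRegret n F = ⨅ lam : ProbabilityMeasure I, ((avgA n lam μ : ℝ) : EReal) := by
  have h0 := distUnit_Iio hF
  rw [iInf_avgA, optRegret]
  have : ∀ x : I, ∫ y : I, kernelA n x y ∂(μ : Measure I) =
      prophetValue n F - ∫ y : I, rewardKernel n x y ∂(quantileMeasure F) := fun x =>
    integral_kernelA_eq n hF μ hμ x.2.1 x.2.2
  simp_rw [this, reward_eq n F h0]
  refine iInf_mixedCDF F h0 (h := fun x =>
    ((prophetValue n F - ∫ y : I, rewardKernel n x y ∂(quantileMeasure F) : ℝ) : EReal)) ?_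
  exact (continuous_coe_real_ereal.tendsto _).comp
    ((tendsto_integral_rewardKernel n F h0 (distUnit_integrable hF)).const_sub _)

lemma exists_measure_of_distUnit {F : ProbabilityMeasure ℝ} (hF : F ∈ distUnit) :
    ∃ μ : ProbabilityMeasure I, (μ : Measure I).restrict (Iio 1) = quantileMeasure F := by
  have hcdf : cdfMap F 1 = 1 := by
    refine Subtype.ext ?_
    have h1 : (F : Measure ℝ) (Iic 1)ᶜ = 0 :=
      measure_mono_null (compl_subset_compl.2 fun x hx => hx.2) hF
    change cdf (F : Measure ℝ) 1 = 1
    rw [cdf_eq_real, measureReal_def, (prob_compl_eq_zero_iff measurableSet_Iic).1 h1]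
    rfl
  -- `F = 1` on `[1, ∞)`, so only levels in `[0, 1)` are pushed forward; the deficit in mass becomes
  -- the atom of `μ` at `1`.
  have hle : quantileMeasure F univ ≤ 1 := by
    rw [quantileMeasure, Measure.map_apply (cdfMap_mono F).measurable .univ, preimage_univ,
      Measure.restrict_apply_univ]
    refine (measure_mono (t := Ico (0 : ℝ) 1) fun z hz => ⟨hz.1, not_le.1 fun h => ?_⟩).trans
      (by simp)
    exact absurd (hcdf ▸ cdfMap_mono F h) (not_le.2 hz.2)
  refine ⟨⟨quantileMeasure F + (1 - quantileMeasure F univ) • Measure.dirac 1, ⟨?_⟩⟩, ?_⟩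
  · simp [add_tsub_cancel_of_le hle]
  · change (quantileMeasure F + (1 - quantileMeasure F univ) • Measure.dirac 1).restrict (Iio 1) = _
    rw [Measure.restrict_add, Measure.restrict_smul,
      Measure.restrict_eq_self_of_ae_mem (s := Iio 1) (ae_quantileMeasure_lt_one F),
      Measure.restrict_eq_zero.2 (by simp), smul_zero, add_zero]

lemma exists_distUnit_of_measure (μ : ProbabilityMeasure I) :
    ∃ F ∈ distUnit, (μ : Measure I).restrict (Iio 1) = quantileMeasure F := by
  set ν : Measure I := (μ : Measure I).restrict (Iio 1) with hν
  have hν1 : ν {1} = 0 := by simp [hν]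
  have hle : ∀ s, ν s ≤ 1 := fun s => (Measure.restrict_apply_le _ _).trans prob_le_one
  refine ⟨quantileLaw ν, ?_, (quantileMeasure_quantileLaw ν hν1
    fun t _ => ne_top_of_le_ne_top ENNReal.one_ne_top (hle _)).symm⟩
  change (quantileLaw ν : Measure ℝ) (Icc 0 1)ᶜ = 0
  rw [quantileLaw_apply ν measurableSet_Icc.compl]
  convert measure_empty (μ := (volume : Measure I))
  -- The quantile function `u ↦ ν [0, u)` is bounded by the total mass of `ν`, which is at most `1`.
  refine eq_empty_of_forall_notMem fun u hu => hu ⟨ENNReal.toReal_nonneg, ?_⟩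
  exact ENNReal.toReal_le_of_le_ofReal zero_le_one (by simpa using hle _)

lemma worstRegret_eq (n : ℕ) [NeZero n] :
    worstRegret n = ⨆ μ : ProbabilityMeasure I, ⨅ lam : ProbabilityMeasure I,
      ((avgA n lam μ : ℝ) : EReal) := by
  apply le_antisymm
  · refine iSup₂_le fun F hF => ?_
    obtain ⟨μ, hμ⟩ := exists_measure_of_distUnit hF
    rw [optRegret_eq n hF μ hμ]
    exact le_iSup (fun μ : ProbabilityMeasure I => ⨅ lam : ProbabilityMeasure I,
      ((avgA n lam μ : ℝ) : EReal)) μ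
  · refine iSup_le fun μ => ?_
    obtain ⟨F, hF, hμ⟩ := exists_distUnit_of_measure μ
    rw [← optRegret_eq n hF μ hμ]
    exact le_iSup₂ (f := fun F (_ : F ∈ distUnit) => optRegret n F) F hF

end Prophet

end

theorem theorem2 (n : ℕ) [NeZero n] :
    -- the two saddlepoint representations
    worstRatio n = (⨅ μ : ProbabilityMeasure I, ⨆ lam : ProbabilityMeasure I,
      ((avgR n lam μ : ℝ) : EReal)) ∧
    worstRegret n = (⨆ μ : ProbabilityMeasure I, ⨅ lam : ProbabilityMeasure I,
      ((avgA n lam μ : ℝ) : EReal)) ∧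
    -- `M_n(F)` and the rewards are linear functionals of the quantile function
    (∀ F : ProbabilityMeasure ℝ, (F : Measure ℝ) (Iio 0) = 0 →
      Integrable (fun x : ℝ => x) (F : Measure ℝ) →
      (Integrable (fun y : I => 1 - (y : ℝ) ^ n) (quantileMeasure F) ∧
        prophetValue n F = ∫ y : I, (1 - (y : ℝ) ^ n) ∂(quantileMeasure F)) ∧
      ∀ (θ : ℝ≥0) (p : I),
        Integrable (fun y : I => rewardKernel n (mixedCDF F p θ) y) (quantileMeasure F) ∧
        reward n F θ p =
          ∫ y : I, rewardKernel n (mixedCDF F p θ) y ∂(quantileMeasure F)) ∧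
    -- the correspondence `dμ = (1 - y ^ n) dF^←` (up to scaling `F`) in the ratio game
    (∀ F ∈ distNonneg, ∃ μ : ProbabilityMeasure I,
      (μ : Measure I) = (ENNReal.ofReal (prophetValue n F))⁻¹ •
        (quantileMeasure F).withDensity (fun y => ENNReal.ofReal (1 - (y : ℝ) ^ n)) ∧
      optRatio n F = ⨆ lam : ProbabilityMeasure I, ((avgR n lam μ : ℝ) : EReal)) ∧
    (∀ μ : ProbabilityMeasure I, (μ : Measure I) {1} = 0 →
      ∃ F ∈ distNonneg, prophetValue n F = 1 ∧
        (μ : Measure I) =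
          (quantileMeasure F).withDensity (fun y => ENNReal.ofReal (1 - (y : ℝ) ^ n))) ∧
    -- the correspondence `dμ = dF^←` on `[0, 1)` in the regret game
    (∀ F ∈ distUnit, ∃ μ : ProbabilityMeasure I,
      (μ : Measure I).restrict (Iio 1) = quantileMeasure F ∧
      optRegret n F = ⨅ lam : ProbabilityMeasure I, ((avgA n lam μ : ℝ) : EReal)) ∧
    (∀ μ : ProbabilityMeasure I, ∃ F ∈ distUnit,
      (μ : Measure I).restrict (Iio 1) = quantileMeasure F) := by
  refine ⟨worstRatio_eq n, worstRegret_eq n, fun F hF hint =>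
    ⟨⟨integrable_one_sub_pow n F hF hint, prophetValue_eq n F hF⟩, fun θ p =>
      ⟨integrable_rewardKernel n F hF hint (mixedCDF_nonneg F p θ) (mixedCDF_le_one F p θ),
        reward_eq n F hF θ p⟩⟩,
    fun F hF => ⟨⟨_, isProbabilityMeasure_ratioMeasure n hF⟩, rfl, optRatio_eq n hF _ rfl⟩,
    fun μ hμ => exists_distNonneg_of_measure n μ hμ, fun F hF => ?_, exists_distUnit_of_measure⟩
  obtain ⟨μ, hμ⟩ := exists_measure_of_distUnit hF
  exact ⟨μ, hμ, optRegret_eq n hF μ hμ⟩
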